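/- For an indeterminate $q$ and integers $n, k \ge 0$, put $(a;q)_n=\prod_{i=0}^{n-1}(1-aq^i)$ (so $(a;q)_0=1$), let ${n\brack k}_q=\frac{(q^{n-k+1};q)_k}{(q;q)_k}$ if $0\le k\le n$ and ${n\brack k}_q=0$ otherwise, and let $[n]=1+q+\cdots+q^{n-1}$. For a polynomial $P\in\mathbb{Q}[q]$, two rational functions $f,g\in\mathbb{Q}(q)$ are congruent modulo $P$, written $f\equiv g\pmod P$, if $f=a/b$ and $g=c/d$ with $a,b,c,d\in\mathbb{Q}[q]$, where $b$ and $d$ are relatively prime to $P$ and $P$ divides $ad-cb$ in $\mathbb{Q}[q]$. Write $\left(\frac{\cdot}{p}\right)$ for the Legendre symbol modulo $p$. Let $p\ge 5$ be a prime and let $s$ be a nonnegative integer. Then the following hold. 1. If $s\le\frac{p-1}{3}$ and $s\equiv\frac{1+\left(\frac{-3}{p}\right)}{2}\pmod 2$, then $$\sum_{k=s}^{(p-1)/2}{2k\brack k+s}_{q^3}\frac{(q;q^3)_k\,(q^2;q^3)_k\,q^{3k}}{(q^6;q^6)_k^2}\equiv 0\pmod{[p]^2}.$$ 2. If $s\le\frac{p-1}{4}$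 and $s\equiv\frac{1+\left(\frac{-2}{p}\right)}{2}\pmod 2$, then $$\sum_{k=s}^{(p-1)/2}{2k\brack k+s}_{q^4}\frac{(q;q^4)_k\,(q^3;q^4)_k\,q^{4k}}{(q^8;q^8)_k^2}\equiv 0\pmod{[p]^2}.$$ 3. If $s\le\frac{p-1}{6}$ and $s\equiv\frac{1+\left(\frac{-1}{p}\right)}{2}\pmod 2$, then $$\sum_{k=s}^{(p-1)/2}{2k\brack k+s}_{q^6}\frac{(q;q^6)_k\,(q^5;q^6)_k\,q^{6k}}{(q^{12};q^{12})_k^2}\equiv 0\pmod{[p]^2}.$$ -/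

import Mathlib

open Polynomial

/-- The `q`-shifted factorial `(a; q)_n = (1 - a)(1 - a q) ⋯ (1 - a q ^ (n - 1))`. -/
def qShifted {K : Type*} [Field K] (a q : K) (n : ℕ) : K :=
  ∏ i ∈ Finset.range n, (1 - a * q ^ i)

/-- The `q`-binomial coefficient to the base `q`. -/
def qBinomial {K : Type*} [Field K] (q : K) (n k : ℕ) : K :=
  if k ≤ n then qShifted (q ^ (n - k + 1)) q k / qShifted q q k else 0

/-- The `q`-integer `[n] = 1 + q + ⋯ + q ^ (n - 1)`, a polynomial in the indeterminate `q`. -/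
noncomputable def qInteger (n : ℕ) : ℚ[X] :=
  ∑ i ∈ Finset.range n, X ^ i

/-- Congruence of rational functions modulo a polynomial `P`: both sides are well defined
modulo `P`, i.e. they are fractions `a / b` and `c / d` of polynomials whose denominators are
relatively prime to `P`, and `P` divides `a d - c b`. -/
def RatCongr (P : ℚ[X]) (f g : RatFunc ℚ) : Prop :=
  ∃ a b c d : ℚ[X], IsCoprime b P ∧ IsCoprime d P ∧
    f = algebraMap ℚ[X] (RatFunc ℚ) a / algebraMap ℚ[X] (RatFunc ℚ) b ∧
    g = algebraMap ℚ[X] (RatFunc ℚ) c / algebraMap ℚ[X] (RatFunc ℚ) d ∧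
    P ∣ a * d - c * b

/-- The indeterminate `q` of the field `ℚ(q)` of rational functions. -/
noncomputable abbrev qVar : RatFunc ℚ := RatFunc.X

/-!
All three congruences are instances of one statement. Let `Q = q ^ m` and suppose that
`p = r + m a` with `0 < r < m`, `s < a` and `a - s` odd. For a parameter `v` put
`S(v) = ∑_{s ≤ k ≤ N} c_k (v; Q)_k (Q / v; Q)_k`, where `N = (p - 1) / 2` and
`c_k = [2k, k + s]_Q Q ^ k / (Q ^ 2; Q ^ 2)_k ^ 2`; the sum in question is `S(q ^ r)`.

Creative telescoping (`qSummand_telescoping`) gives a first-order recurrence in `v`: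
with `y = 1 / (Q v)` and `w = Q ^ s`,
`(1 - v w)(1 - v / w) S(v) = (1 - w y)(1 - y / w) Q v ^ 2 S(Q ^ 2 v) + boundary term`,
and the boundary term at `N` carries the factors `1 - Q ^ (2 N + 1) = 1 - Q ^ p` and
`(v; Q)_{N + 1}`. For `v = q ^ r = q ^ p Q ^ (-a)` with `a ≤ N` the latter contains `1 - q ^ p`,
so the boundary term is divisible by `[p] ^ 2`, while the coefficient of `S(v)` is invertible
modulo `[p]`. The divisibility of `S(Q ^ 2 v)` by `[p] ^ 2` therefore passes to `S(v)`
(`localDvd_sum_of_shift`), which reduces the claim for `a` to the claim for `a - 2`. The descent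
ends at `a = s + 1`: there
`y / w = q ^ (-p)`, so the right-hand coefficient vanishes modulo `[p]`; the second factor `[p]`
comes from `(Q ^ 2 v; Q)_k`, which contains `1 - q ^ p` for `k ≥ s` if `s > 0`, and from
`w y = y / w` if `s = 0`.

Since `[p]` is the cyclotomic polynomial of index `p`, it is relatively prime to `q ^ j - 1`
whenever `p ∤ j`. All divisibilities are in the ring of fractions with denominators relatively
prime to `[p]`. Finally `r` is the residue of `p` modulo `m`, and the quadratic characters of
`-3`, `-2`, `-1` determine the parity of `a = ⌊p / m⌋`.
-/

/-! ### Shifted factorials and the telescoping identity -/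

section
variable {K : Type*} [Field K]

theorem qShifted_succ (a q : K) (n : ℕ) :
    qShifted a q (n + 1) = qShifted a q n * (1 - a * q ^ n) :=
  Finset.prod_range_succ _ _

theorem qShifted_add (a q : K) (m n : ℕ) :
    qShifted a q (m + n) = qShifted a q m * qShifted (a * q ^ m) q n := by
  simp only [qShifted, Finset.prod_range_add, mul_assoc, pow_add]

theorem qShifted_ne_zero {q : K} (hq : ∀ j : ℕ, 0 < j → q ^ j ≠ 1) (n : ℕ) :
    qShifted q q n ≠ 0 := by
  refine Finset.prod_ne_zero_iff.2 fun i _ h => hq (i + 1) i.succ_pos ?_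
  rw [pow_succ']
  exact (sub_eq_zero.1 h).symm

/-- `(1 - a) (1 - q a) (q ^ 2 a; q)_k = (a; q)_k (1 - a q ^ k) (1 - q a q ^ k)`. -/
theorem qShifted_shift_two (a q : K) (k : ℕ) :
    (1 - a) * (1 - q * a) * qShifted (q ^ 2 * a) q k =
      qShifted a q k * ((1 - a * q ^ k) * (1 - q * a * q ^ k)) := by
  have h := qShifted_add a q 2 k
  rw [add_comm, qShifted_add] at h
  simp only [qShifted, Finset.prod_range_succ, Finset.prod_range_zero] at h ⊢
  rw [mul_comm (q ^ 2) a]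
  linear_combination -h

/-- The central `q`-binomial coefficient as a quotient of `q`-factorials. -/
theorem qBinomial_mul_qShifted {q : K} (hq : ∀ j : ℕ, 0 < j → q ^ j ≠ 1) (s j : ℕ) :
    qBinomial q (2 * (s + j)) (s + j + s) * (qShifted q q j * qShifted q q (s + j + s)) =
      qShifted q q (2 * (s + j)) := by
  have h1 : 2 * (s + j) - (s + j + s) + 1 = j + 1 := by omega
  have h2 : 2 * (s + j) = j + (s + j + s) := by ring
  rw [qBinomial, if_pos (by omega), h1, h2, qShifted_add q q j, pow_succ']
  field_simp [qShifted_ne_zero hq (s + j + s)]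

/-- The factor `[2k, k + s] q ^ k / (q ^ 2; q ^ 2)_k ^ 2` of the summands. -/
noncomputable def qWeight (q : K) (s k : ℕ) : K :=
  qBinomial q (2 * k) (k + s) * q ^ k / qShifted (q ^ 2) (q ^ 2) k ^ 2

/-- The general summand, with base `q` and the parameters `v` and `q / v`. -/
noncomputable def qSummand (q : K) (s : ℕ) (v : K) (k : ℕ) : K :=
  qWeight q s k * (qShifted v q k * qShifted (q / v) q k)

/-- The term ratio of the weights, with `k = s + j`. -/
theorem qWeight_succ {q : K} (hq : ∀ j : ℕ, 0 < j → q ^ j ≠ 1) (s j : ℕ) :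
    qWeight q s (s + j + 1) * ((1 - q ^ (s + j + s + 1)) * (1 - q ^ (j + 1)) *
      (1 - q ^ (2 * (s + j) + 2))) = q * (1 - q ^ (2 * (s + j) + 1)) * qWeight q s (s + j) := by
  have hb := qBinomial_mul_qShifted hq s j
  have hb' := qBinomial_mul_qShifted hq s (j + 1)
  rw [show s + (j + 1) = s + j + 1 by ring, show s + j + 1 + s = (s + j + s) + 1 by ring,
    show 2 * (s + j + 1) = 2 * (s + j) + 1 + 1 by ring] at hb'
  simp only [qShifted_succ q q] at hb'
  have hq2 : ∀ j : ℕ, 0 < j → (q ^ 2) ^ j ≠ 1 := fun j hj => by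
    rw [← pow_mul]; exact hq _ (by omega)
  have e2 := qShifted_ne_zero hq2 (s + j)
  have e1 := qShifted_ne_zero hq j
  have e3 := qShifted_ne_zero hq (s + j + s)
  have e4 : 1 - q ^ (2 * (s + j) + 2) ≠ 0 := sub_ne_zero.2 (hq _ (by omega)).symm
  have e4' : 1 - q ^ 2 * (q ^ 2) ^ (s + j) ≠ 0 := by
    convert e4 using 2
    ring
  rw [← hb] at hb'
  simp only [qWeight, qShifted_succ (q ^ 2), show s + j + 1 + s = (s + j + s) + 1 by ring,
    show 2 * (s + j + 1) = 2 * (s + j) + 1 + 1 by ring]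
  rw [show 1 - q ^ 2 * (q ^ 2) ^ (s + j) = 1 - q ^ (2 * (s + j) + 2) by ring]
  have key : qBinomial q (2 * (s + j) + 1 + 1) (s + j + s + 1) *
      ((1 - q ^ (s + j + s + 1)) * (1 - q ^ (j + 1))) =
      qBinomial q (2 * (s + j)) (s + j + s) * (1 - q ^ (2 * (s + j) + 1)) *
        (1 - q ^ (2 * (s + j) + 2)) := by
    apply mul_right_cancel₀ (mul_ne_zero e1 e3)
    linear_combination hb'
  rw [div_mul_eq_mul_div, mul_div_assoc',
    div_eq_div_iff (pow_ne_zero 2 (mul_ne_zero e2 e4)) (pow_ne_zero 2 e2)]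
  linear_combination q ^ (s + j + 1) * (1 - q ^ (2 * (s + j) + 2)) *
    qShifted (q ^ 2) (q ^ 2) (s + j) ^ 2 * key

/-- The rational function identity behind the telescoping, with `z = q ^ k` and `w = q ^ s`. The
second product on the right vanishes at `k = s`, which starts the telescoping. -/
theorem telescoping_core {q v y w z : K} (h : q * v * y = 1) (hw : w ≠ 0) (hz : z ≠ 0) :
    (1 - v * w) * (1 - v / w) * ((1 - y * z) * (1 - q * y * z)) -
      (1 - w * y) * (1 - y / w) * ((1 - v * z) * (1 - q * v * z)) =
    -(v - y) * (((1 - q * z ^ 2) * ((1 - v * z) * (1 - y * z)) -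
      (1 - z * w) * (1 - z / w) * (1 - z ^ 2)) / z) := by
  have hv : v ≠ 0 := by rintro rfl; simp at h
  have hy : y ≠ 0 := by rintro rfl; simp at h
  have hq : q = 1 / (v * y) := by field_simp; linear_combination h
  subst hq
  field_simp
  ring
/-- The summands at `v` and `q ^ 2 v` are rational multiples of the same product, by
`qShifted_shift_two` applied to `v` and to `y = 1 / (q v)`. -/
theorem qSummand_contiguous {q v y w : K} (h : q * v * y = 1) (s k : ℕ) :
    (1 - y) * (1 - q * y) * ((1 - v * w) * (1 - v / w) * qSummand q s v k -
      (1 - w * y) * (1 - y / w) * (q * v ^ 2 * qSummand q s (q ^ 2 * v) k)) =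
    qWeight q s k * (qShifted v q k * qShifted y q k) *
      ((1 - v * w) * (1 - v / w) * ((1 - y * q ^ k) * (1 - q * y * q ^ k)) -
      (1 - w * y) * (1 - y / w) * ((1 - v * q ^ k) * (1 - q * v * q ^ k))) := by
  have hv : v ≠ 0 := by rintro rfl; simp at h
  have hq : q ≠ 0 := by rintro rfl; simp at h
  have e1 : q / v = q ^ 2 * y := by field_simp; linear_combination -h
  have e2 : q / (q ^ 2 * v) = y := by field_simp; linear_combination -h
  have e3 : q * v ^ 2 * ((1 - y) * (1 - q * y)) = (1 - v) * (1 - q * v) := by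
    linear_combination (-v - q * v + q * v * y + 1) * h
  have h1 := qShifted_shift_two y q k
  have h2 := qShifted_shift_two v q k
  rw [← e3] at h2
  rw [qSummand, qSummand, e1, e2]
  linear_combination (1 - v * w) * (1 - v / w) * qWeight q s k * qShifted v q k * h1 -
    (1 - w * y) * (1 - y / w) * qWeight q s k * qShifted y q k * h2

/-- Creative telescoping: the combination of the sums at `v` and `q ^ 2 v` in closed form. -/
theorem qSummand_telescoping {q v y : K} (hq : ∀ j : ℕ, 0 < j → q ^ j ≠ 1)
    (h : q * v * y = 1) (s j : ℕ) :
    (1 - y) * (1 - q * y) * ∑ k ∈ Finset.Icc s (s + j),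
      ((1 - v * q ^ s) * (1 - v / q ^ s) * qSummand q s v k -
        (1 - q ^ s * y) * (1 - y / q ^ s) * (q * v ^ 2 * qSummand q s (q ^ 2 * v) k)) =
    -(v - y) * ((1 - q ^ (2 * (s + j) + 1)) / q ^ (s + j)) * qWeight q s (s + j) *
      (qShifted v q (s + j + 1) * qShifted y q (s + j + 1)) := by
  have hq0 : q ≠ 0 := by rintro rfl; simp at h
  have core := fun k => telescoping_core (z := q ^ k) h (pow_ne_zero s hq0) (pow_ne_zero k hq0)
  have e : ∀ n : ℕ, 1 - q ^ (2 * n + 1) = 1 - q * (q ^ n) ^ 2 := fun n => by ring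
  induction j with
  | zero =>
    rw [add_zero, Finset.Icc_self, Finset.sum_singleton, qSummand_contiguous h, core,
      div_self (pow_ne_zero s hq0), e, qShifted_succ, qShifted_succ]
    ring
  | succ j ih =>
    have hw := qWeight_succ hq s j
    rw [← add_assoc, Finset.sum_Icc_succ_top (by omega), mul_add, ih, qSummand_contiguous h, core,
      e (s + j + 1), qShifted_succ _ _ (s + j + 1), qShifted_succ _ _ (s + j + 1)]
    have e1 : q ^ (s + j + 1) * q ^ s = q ^ (s + j + s + 1) := by ring
    have e2 : q ^ (s + j + 1) / q ^ s = q ^ (j + 1) := by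
      rw [div_eq_iff (pow_ne_zero s hq0)]; ring
    have e3 : 1 - (q ^ (s + j + 1)) ^ 2 = 1 - q ^ (2 * (s + j) + 2) := by ring
    have e4 : (1 - q ^ (2 * (s + j) + 1)) / q ^ (s + j) * qWeight q s (s + j) =
        qWeight q s (s + j + 1) * ((1 - q ^ (s + j + s + 1)) * (1 - q ^ (j + 1)) *
          (1 - q ^ (2 * (s + j) + 2))) / q ^ (s + j + 1) := by
      rw [hw, pow_succ q (s + j)]
      field_simp
    rw [e1, e2, e3]
    linear_combination -(v - y) * (qShifted v q (s + j + 1) * qShifted y q (s + j + 1)) * e4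
end

/-! ### Divisibility in a local ring of rational functions -/

/-- A rational function is divisible by `P ^ n` in the local ring of fractions with denominators
relatively prime to `P`. The condition `b ≠ 0` matters only when `P` is a unit. For `n = 0` it says
that the function belongs to this ring. -/
def LocalDvd (P : ℚ[X]) (n : ℕ) (f : RatFunc ℚ) : Prop :=
  ∃ a b : ℚ[X], IsCoprime b P ∧ b ≠ 0 ∧
    f * algebraMap ℚ[X] (RatFunc ℚ) b = algebraMap ℚ[X] (RatFunc ℚ) (P ^ n * a)

namespace LocalDvd
variable {P : ℚ[X]} {m n : ℕ} {f g : RatFunc ℚ}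

theorem of_poly (n : ℕ) {a : ℚ[X]} (h : P ^ n ∣ a) :
    LocalDvd P n (algebraMap ℚ[X] (RatFunc ℚ) a) := by
  obtain ⟨c, rfl⟩ := h
  exact ⟨c, 1, isCoprime_one_left, one_ne_zero, by simp⟩

theorem inv_of_coprime {b : ℚ[X]} (h : IsCoprime b P) (hb : b ≠ 0) :
    LocalDvd P 0 (algebraMap ℚ[X] (RatFunc ℚ) b)⁻¹ := by
  refine ⟨1, b, h, hb, ?_⟩
  simp [inv_mul_cancel₀ (RatFunc.algebraMap_ne_zero hb)]

theorem mul (hf : LocalDvd P m f) (hg : LocalDvd P n g) : LocalDvd P (m + n) (f * g) := by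
  obtain ⟨a, b, hb, hb0, h⟩ := hf
  obtain ⟨c, d, hd, hd0, h'⟩ := hg
  refine ⟨a * c, b * d, hb.mul_left hd, mul_ne_zero hb0 hd0, ?_⟩
  simp only [map_mul, map_pow] at h h' ⊢
  rw [mul_mul_mul_comm, h, h']
  ring

theorem mul_integral (hf : LocalDvd P n f) (hg : LocalDvd P 0 g) : LocalDvd P n (f * g) := by
  have h := hf.mul hg
  rwa [add_zero] at h

theorem integral_mul (hf : LocalDvd P 0 f) (hg : LocalDvd P n g) : LocalDvd P n (f * g) := by
  rw [mul_comm]; exact hg.mul_integral hf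

theorem add (hf : LocalDvd P n f) (hg : LocalDvd P n g) : LocalDvd P n (f + g) := by
  obtain ⟨a, b, hb, hb0, h⟩ := hf
  obtain ⟨c, d, hd, hd0, h'⟩ := hg
  refine ⟨a * d + c * b, b * d, hb.mul_left hd, mul_ne_zero hb0 hd0, ?_⟩
  simp only [map_mul, map_pow, map_add] at h h' ⊢
  linear_combination algebraMap ℚ[X] (RatFunc ℚ) d * h + algebraMap ℚ[X] (RatFunc ℚ) b * h'

theorem zero (n : ℕ) : LocalDvd P n 0 := by
  simpa using of_poly n (dvd_zero (P ^ n))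

theorem one : LocalDvd P 0 1 := by
  simpa using of_poly 0 (P := P) (a := 1) (by simp)

theorem neg (hf : LocalDvd P n f) : LocalDvd P n (-f) := by
  have h : LocalDvd P 0 (-1) := by simpa using of_poly 0 (P := P) (a := -1) (by simp)
  simpa using h.integral_mul hf

theorem sum {ι : Type*} {s : Finset ι} {F : ι → RatFunc ℚ} (h : ∀ i ∈ s, LocalDvd P n (F i)) :
    LocalDvd P n (∑ i ∈ s, F i) := by
  classical
  induction s using Finset.induction_on with
  | empty => simpa using zero n
  | insert a s ha ih =>
    rw [Finset.sum_insert ha]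
    exact (h a (by simp)).add (ih fun i hi => h i (by simp [hi]))

theorem prod {ι : Type*} {s : Finset ι} {F : ι → RatFunc ℚ} (h : ∀ i ∈ s, LocalDvd P 0 (F i)) :
    LocalDvd P 0 (∏ i ∈ s, F i) := by
  classical
  induction s using Finset.induction_on with
  | empty => simpa using one
  | insert a s ha ih =>
    rw [Finset.prod_insert ha]
    exact (h a (by simp)).mul_integral (ih fun i hi => h i (by simp [hi]))

theorem pow (hf : LocalDvd P 0 f) (k : ℕ) : LocalDvd P 0 (f ^ k) := by
  simpa using prod (s := Finset.range k) (F := fun _ => f) fun _ _ => hf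

theorem of_mul_left (hf : f ≠ 0) (hf' : LocalDvd P 0 f⁻¹) (h : LocalDvd P n (f * g)) :
    LocalDvd P n g := by
  simpa [← mul_assoc, inv_mul_cancel₀ hf] using hf'.integral_mul h

theorem ratCongr (hf : LocalDvd P n f) : RatCongr (P ^ n) f 0 := by
  obtain ⟨a, b, hb, hb0, h⟩ := hf
  refine ⟨P ^ n * a, b, 0, 1, hb.pow_right, isCoprime_one_left, ?_, by simp, by simp⟩
  rw [eq_div_iff (RatFunc.algebraMap_ne_zero hb0), h]

end LocalDvd

/-! ### The powers of `q` modulo `[p]` -/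

theorem qInteger_dvd {p n : ℕ} (h : p ∣ n) : qInteger p ∣ X ^ n - 1 := by
  obtain ⟨c, rfl⟩ := h
  rw [pow_mul]
  refine Dvd.dvd.trans ⟨X - 1, (geom_sum_mul X p).symm⟩ ?_
  simpa using sub_dvd_pow_sub_pow (X ^ p : ℚ[X]) 1 c

section
variable {p : ℕ} [hp : Fact p.Prime]

theorem qInteger_eq_cyclotomic : qInteger p = cyclotomic p ℚ :=
  (cyclotomic_prime ℚ p).symm

theorem isCoprime_X_pow_sub_one {n : ℕ} (h : ¬ p ∣ n) : IsCoprime (X ^ n - 1) (qInteger p) := by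
  have hn : 0 < n := Nat.pos_of_ne_zero (by rintro rfl; simp at h)
  rw [← prod_cyclotomic_eq_X_pow_sub_one hn, qInteger_eq_cyclotomic]
  refine IsCoprime.prod_left fun i hi => cyclotomic.isCoprime_rat ?_
  rintro rfl
  exact h (Nat.dvd_of_mem_divisors hi)

theorem isCoprime_X : IsCoprime (X : ℚ[X]) (qInteger p) := by
  obtain ⟨n, hn⟩ := Nat.exists_eq_succ_of_ne_zero hp.out.ne_zero
  refine ⟨-∑ i ∈ Finset.range n, X ^ i, 1, ?_⟩
  rw [hn, qInteger, Finset.sum_range_succ', Finset.sum_congr rfl fun i _ => pow_succ _ _,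
    ← Finset.sum_mul]
  ring

theorem qVar_eq : qVar = algebraMap ℚ[X] (RatFunc ℚ) X := RatFunc.algebraMap_X.symm

theorem qVar_ne_zero : qVar ≠ 0 := RatFunc.X_ne_zero

theorem localDvd_qVar_zpow (z : ℤ) : LocalDvd (qInteger p) 0 (qVar ^ z) := by
  have h1 : LocalDvd (qInteger p) 0 qVar := by
    rw [qVar_eq]; exact .of_poly 0 (by simp)
  have h2 : LocalDvd (qInteger p) 0 qVar⁻¹ := by
    rw [qVar_eq]; exact .inv_of_coprime isCoprime_X X_ne_zero
  obtain ⟨n, rfl | rfl⟩ := z.eq_nat_or_neg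
  · simpa using h1.pow n
  · simpa using h2.pow n

theorem qVar_pow_ne_one {n : ℕ} (h : 0 < n) : qVar ^ n ≠ 1 := by
  intro e
  rw [qVar_eq, ← map_pow, ← map_one (algebraMap ℚ[X] (RatFunc ℚ))] at e
  have := congrArg natDegree (RatFunc.algebraMap_injective ℚ e)
  simp at this
  omega

theorem qVar_zpow_ne_one {z : ℤ} (h : z ≠ 0) : qVar ^ z ≠ 1 := by
  obtain ⟨n, rfl | rfl⟩ := z.eq_nat_or_neg
  · simpa using qVar_pow_ne_one (n := n) (by omega)
  · simpa using qVar_pow_ne_one (n := n) (by omega)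

theorem one_sub_qVar_zpow_neg (n : ℕ) :
    1 - qVar ^ (-(n : ℤ)) = qVar ^ (-(n : ℤ)) * algebraMap ℚ[X] (RatFunc ℚ) (X ^ n - 1) := by
  have h : qVar ^ n ≠ 0 := pow_ne_zero n qVar_ne_zero
  simp [mul_sub, inv_mul_cancel₀ h]

theorem one_sub_qVar_pow (n : ℕ) :
    1 - qVar ^ (n : ℤ) = -algebraMap ℚ[X] (RatFunc ℚ) (X ^ n - 1) := by
  simp

theorem localDvd_one_sub (z : ℤ) : LocalDvd (qInteger p) 0 (1 - qVar ^ z) := by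
  rw [sub_eq_add_neg]
  exact LocalDvd.one.add (localDvd_qVar_zpow z).neg

theorem localDvd_one_one_sub {z : ℤ} (h : (p : ℤ) ∣ z) :
    LocalDvd (qInteger p) 1 (1 - qVar ^ z) := by
  obtain ⟨n, rfl | rfl⟩ := z.eq_nat_or_neg
  · rw [one_sub_qVar_pow]
    exact (LocalDvd.of_poly 1 (by simpa using qInteger_dvd (by exact_mod_cast h))).neg
  · rw [one_sub_qVar_zpow_neg]
    refine (localDvd_qVar_zpow _).integral_mul (LocalDvd.of_poly 1 ?_)
    rw [dvd_neg] at h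
    simpa using qInteger_dvd (by exact_mod_cast h)

theorem localDvd_inv_one_sub {z : ℤ} (h : ¬ (p : ℤ) ∣ z) :
    LocalDvd (qInteger p) 0 (1 - qVar ^ z)⁻¹ := by
  have key : ∀ n : ℕ, ¬ p ∣ n →
      LocalDvd (qInteger p) 0 (algebraMap ℚ[X] (RatFunc ℚ) (X ^ n - 1))⁻¹ := fun n hn =>
    .inv_of_coprime (isCoprime_X_pow_sub_one hn) (X_pow_sub_C_ne_zero
      (Nat.pos_of_ne_zero (by rintro rfl; simp at hn)) 1)
  obtain ⟨n, rfl | rfl⟩ := z.eq_nat_or_neg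
  · rw [one_sub_qVar_pow, inv_neg]
    exact (key n (by exact_mod_cast h)).neg
  · rw [one_sub_qVar_zpow_neg, mul_inv, ← zpow_neg]
    rw [dvd_neg] at h
    exact (localDvd_qVar_zpow _).mul_integral (key n (by exact_mod_cast h))

theorem localDvd_qShifted {z y : ℤ} (k : ℕ) :
    LocalDvd (qInteger p) 0 (qShifted (qVar ^ z) (qVar ^ y) k) := by
  refine LocalDvd.prod fun i _ => ?_
  rw [← zpow_natCast, ← zpow_mul, ← zpow_add₀ qVar_ne_zero]
  exact localDvd_one_sub _

/-- A shifted factorial is divisible by `[p]` as soon as one of its factors is `1 - q ^ j` with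
`p ∣ j`. -/
theorem localDvd_one_qShifted {z y : ℤ} {k i : ℕ} (hi : i < k) (h : (p : ℤ) ∣ z + y * i) :
    LocalDvd (qInteger p) 1 (qShifted (qVar ^ z) (qVar ^ y) k) := by
  rw [qShifted, ← Finset.mul_prod_erase _ _ (Finset.mem_range.2 hi)]
  refine LocalDvd.mul_integral ?_ (LocalDvd.prod fun i _ => ?_)
  all_goals rw [← zpow_natCast, ← zpow_mul, ← zpow_add₀ qVar_ne_zero]
  · exact localDvd_one_one_sub h
  · exact localDvd_one_sub _

theorem localDvd_inv_qShifted {z y : ℤ} {k : ℕ} (h : ∀ i : ℕ, i < k → ¬ (p : ℤ) ∣ z + y * i) :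
    LocalDvd (qInteger p) 0 (qShifted (qVar ^ z) (qVar ^ y) k)⁻¹ := by
  rw [qShifted, ← Finset.prod_inv_distrib]
  refine LocalDvd.prod fun i hi => ?_
  rw [← zpow_natCast, ← zpow_mul, ← zpow_add₀ qVar_ne_zero]
  exact localDvd_inv_one_sub (h i (Finset.mem_range.1 hi))
end

/-! ### Descent in the parameter -/

section
variable {p : ℕ} [hp : Fact p.Prime]

theorem qVar_zpow_pow (z : ℤ) (n : ℕ) : (qVar ^ z) ^ n = qVar ^ (z * n) := by
  rw [zpow_mul, zpow_natCast]

theorem not_dvd_mul_of_lt {m : ℤ} (hm : ¬ (p : ℤ) ∣ m) {i : ℕ} (h0 : 0 < i) (hi : i < p) :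
    ¬ (p : ℤ) ∣ m * i := fun h =>
  ((Nat.prime_iff_prime_int.1 hp.out).dvd_or_dvd h).elim hm fun h =>
    absurd (Nat.le_of_dvd h0 (by exact_mod_cast h)) (by omega)

/-- The weights have no denominators divisible by `[p]` as long as `k + s < p`. -/
theorem localDvd_qWeight {m : ℤ} (hm : ¬ (p : ℤ) ∣ 2 * m) {s k : ℕ} (hk : k + s < p) :
    LocalDvd (qInteger p) 0 (qWeight (qVar ^ m) s k) := by
  have hm' : ¬ (p : ℤ) ∣ m := fun h => hm (h.mul_left 2)
  have hb : LocalDvd (qInteger p) 0 (qBinomial (qVar ^ m) (2 * k) (k + s)) := by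
    rw [qBinomial]
    split_ifs with h
    · rw [div_eq_mul_inv, qVar_zpow_pow]
      refine (localDvd_qShifted _).mul_integral (localDvd_inv_qShifted fun i hi => ?_)
      have := not_dvd_mul_of_lt hm' i.succ_pos (by omega)
      convert this using 2
      push_cast; ring
    · exact .zero _
  rw [qWeight, div_eq_mul_inv, ← inv_pow]
  simp only [qVar_zpow_pow]
  refine (hb.mul_integral (localDvd_qVar_zpow _)).mul_integral
    (LocalDvd.pow (localDvd_inv_qShifted fun i hi => ?_) 2)
  have := not_dvd_mul_of_lt hm i.succ_pos (by omega)
  convert this using 2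
  push_cast; ring

theorem localDvd_qSummand {m z : ℤ} (hm : ¬ (p : ℤ) ∣ 2 * m) {s k : ℕ} (hk : k + s < p) :
    LocalDvd (qInteger p) 0 (qSummand (qVar ^ m) s (qVar ^ z) k) := by
  rw [qSummand, ← zpow_sub₀ qVar_ne_zero]
  exact (localDvd_qWeight hm hk).mul_integral
    ((localDvd_qShifted k).mul_integral (localDvd_qShifted k))

theorem localDvd_one_qSummand {m z : ℤ} (hm : ¬ (p : ℤ) ∣ 2 * m) {s k i : ℕ} (hk : k + s < p)
    (hi : i < k) (h : (p : ℤ) ∣ z + m * i) :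
    LocalDvd (qInteger p) 1 (qSummand (qVar ^ m) s (qVar ^ z) k) := by
  rw [qSummand, ← zpow_sub₀ qVar_ne_zero]
  exact (localDvd_qWeight hm hk).integral_mul
    ((localDvd_one_qShifted hi h).mul_integral (localDvd_qShifted k))

/-- The recurrence modulo `[p] ^ 2`: divisibility passes from the sum at `q ^ (r + 2m)`, multiplied
by its coefficient, to the sum at `q ^ r`. -/
theorem localDvd_sum_of_shift {m r a s N : ℕ} (hm : ¬ p ∣ 2 * m) (hr : 0 < r) (hN : p = 2 * N + 1)
    (ha : p = r + m * a) (hsa : s < a) (haN : a ≤ N)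
    (h : LocalDvd (qInteger p) 2 ((1 - qVar ^ (m * s - m - r : ℤ)) *
      (1 - qVar ^ (-(m * s) - m - r : ℤ)) *
      ∑ k ∈ Finset.Icc s N, qSummand (qVar ^ (m : ℤ)) s (qVar ^ (r + 2 * m : ℤ)) k)) :
    LocalDvd (qInteger p) 2
      (∑ k ∈ Finset.Icc s N, qSummand (qVar ^ (m : ℤ)) s (qVar ^ (r : ℤ)) k) := by
  have hm1 : ¬ (p : ℤ) ∣ 2 * m := by exact_mod_cast hm
  have hm' : ¬ (p : ℤ) ∣ m := fun h => hm1 (h.mul_left 2)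
  have hm0 : 0 < m := Nat.pos_of_ne_zero (by rintro rfl; simp at hm)
  have haz : (p : ℤ) = r + m * a := by exact_mod_cast ha
  obtain ⟨n, rfl⟩ : ∃ n, N = n + 1 := ⟨N - 1, by omega⟩
  set Q : RatFunc ℚ := qVar ^ (m : ℤ) with hQ
  set v : RatFunc ℚ := qVar ^ (r : ℤ) with hv
  set y : RatFunc ℚ := qVar ^ (-m - r : ℤ) with hy
  have hQvy : Q * v * y = 1 := by
    rw [hQ, hv, hy, ← zpow_add₀ qVar_ne_zero, ← zpow_add₀ qVar_ne_zero]
    ring_nf; simp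
  have hQ1 : ∀ j : ℕ, 0 < j → Q ^ j ≠ 1 := fun j hj => by
    rw [hQ, qVar_zpow_pow]
    exact qVar_zpow_ne_one (by positivity)
  have hQy : Q * y = qVar ^ (-r : ℤ) := by
    rw [hQ, hy, ← zpow_add₀ qVar_ne_zero]; ring_nf
  have hy1 : 1 - y ≠ 0 := sub_ne_zero.2 (qVar_zpow_ne_one (by omega)).symm
  have hy2 : 1 - Q * y ≠ 0 := by
    rw [hQy]; exact sub_ne_zero.2 (qVar_zpow_ne_one (by omega)).symm
  have hvs : Q ^ 2 * v = qVar ^ (r + 2 * m : ℤ) := by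
    rw [hQ, hv, qVar_zpow_pow, ← zpow_add₀ qVar_ne_zero]; push_cast; ring_nf
  have T := qSummand_telescoping hQ1 hQvy s (n + 1 - s)
  rw [Nat.add_sub_cancel' (by omega : s ≤ n + 1)] at T
  have T2 := qShifted_shift_two y Q n
  -- The factors `(1 - y)(1 - Q y)` must be cancelled before counting factors `[p]`: for
  -- `a = 1` the first one is itself divisible by `[p]`.
  have T3 : qShifted y Q (n + 1 + 1) = (1 - y) * (1 - Q * y) * qShifted (Q ^ 2 * y) Q n := by
    rw [T2, qShifted_succ, qShifted_succ]; ring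
  rw [T3, Finset.sum_sub_distrib, ← Finset.mul_sum, ← Finset.mul_sum, ← Finset.mul_sum, hvs] at T
  set S := ∑ k ∈ Finset.Icc s (n + 1), qSummand Q s v k with hS
  set S' := ∑ k ∈ Finset.Icc s (n + 1), qSummand Q s (qVar ^ (r + 2 * m : ℤ)) k with hS'
  have e1 : v * Q ^ s = qVar ^ (r + m * s : ℤ) := by
    rw [hQ, hv, qVar_zpow_pow, ← zpow_add₀ qVar_ne_zero]
  have e2 : v / Q ^ s = qVar ^ (r - m * s : ℤ) := by
    rw [hQ, hv, qVar_zpow_pow, ← zpow_sub₀ qVar_ne_zero]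
  have e3 : Q ^ s * y = qVar ^ (m * s - m - r : ℤ) := by
    rw [hQ, hy, qVar_zpow_pow, ← zpow_add₀ qVar_ne_zero]; ring_nf
  have e4 : y / Q ^ s = qVar ^ (-(m * s) - m - r : ℤ) := by
    rw [hQ, hy, qVar_zpow_pow, ← zpow_sub₀ qVar_ne_zero]; ring_nf
  have e5 : Q * v ^ 2 = qVar ^ (m + r * 2 : ℤ) := by
    rw [hQ, hv, qVar_zpow_pow, ← zpow_add₀ qVar_ne_zero]; push_cast; ring_nf
  have e6 : (1 - Q ^ (2 * (n + 1) + 1)) / Q ^ (n + 1) =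
      (1 - qVar ^ (m * p : ℤ)) * qVar ^ (-(m * (n + 1)) : ℤ) := by
    rw [← hN, hQ, qVar_zpow_pow, qVar_zpow_pow, zpow_neg, div_eq_mul_inv]; push_cast; rfl
  rw [e1, e2, e3, e4, e5, e6] at T
  have T4 : (1 - qVar ^ (r + m * s : ℤ)) * ((1 - qVar ^ (r - m * s : ℤ)) * S) =
      qVar ^ (m + r * 2 : ℤ) * ((1 - qVar ^ (m * s - m - r : ℤ)) *
        (1 - qVar ^ (-(m * s) - m - r : ℤ)) * S') +
      -((v + -y) * (qVar ^ (-(m * (n + 1)) : ℤ) * qWeight Q s (n + 1) *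
        qShifted (Q ^ 2 * y) Q n) * ((1 - qVar ^ (m * p : ℤ)) * qShifted v Q (n + 1 + 1))) := by
    apply mul_left_cancel₀ (mul_ne_zero hy1 hy2)
    linear_combination T
  have unit : ∀ z : ℤ, ¬ (p : ℤ) ∣ z → ∀ f, LocalDvd (qInteger p) 2 ((1 - qVar ^ z) * f) →
      LocalDvd (qInteger p) 2 f := fun z hz f hf =>
    LocalDvd.of_mul_left (sub_ne_zero.2 (qVar_zpow_ne_one (by rintro rfl; simp at hz)).symm)
      (localDvd_inv_one_sub hz) hf
  have n1 : ¬ (p : ℤ) ∣ r + m * s := fun h => by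
    have h2 := dvd_sub (dvd_refl (p : ℤ)) h
    rw [show (p : ℤ) - (r + m * s) = m * ((a - s : ℕ) : ℤ) by
      rw [haz]; push_cast [hsa.le]; ring] at h2
    exact not_dvd_mul_of_lt hm' (by omega) (by omega) h2
  have n2 : ¬ (p : ℤ) ∣ r - m * s := fun h => by
    have h2 := dvd_sub (dvd_refl (p : ℤ)) h
    rw [show (p : ℤ) - (r - m * s) = m * ((a + s : ℕ) : ℤ) by
      rw [haz]; push_cast; ring] at h2
    exact not_dvd_mul_of_lt hm' (by omega) (by omega) h2
  refine unit _ n2 _ (unit _ n1 _ ?_)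
  rw [T4]
  refine ((localDvd_qVar_zpow _).integral_mul h).add (LocalDvd.neg (LocalDvd.integral_mul ?_ ?_))
  · refine ((localDvd_qVar_zpow _).add (localDvd_qVar_zpow _).neg).mul_integral
      (((localDvd_qVar_zpow _).mul_integral (localDvd_qWeight hm1 (by omega))).mul_integral ?_)
    rw [pow_two, mul_assoc, hQy, hQ, ← zpow_add₀ qVar_ne_zero]
    exact localDvd_qShifted n
  · exact LocalDvd.mul (m := 1) (n := 1) (localDvd_one_one_sub (dvd_mul_left _ _))
      (localDvd_one_qShifted (i := a) (by omega) (by rw [haz]))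

/-- Descent from `a = s + 1 + 2 d` to `a = s + 1`, where `p = r + m a`. -/
theorem localDvd_sum_qSummand {m s N : ℕ} (hm : ¬ p ∣ 2 * m) (hN : p = 2 * N + 1) (d : ℕ) :
    ∀ r : ℕ, 0 < r → p = r + m * (s + 1 + 2 * d) → s + 1 + 2 * d ≤ N →
    LocalDvd (qInteger p) 2
      (∑ k ∈ Finset.Icc s N, qSummand (qVar ^ (m : ℤ)) s (qVar ^ (r : ℤ)) k) := by
  have hm1 : ¬ (p : ℤ) ∣ 2 * m := by exact_mod_cast hm
  induction d with
  | zero =>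
    intro r hr ha haN
    refine localDvd_sum_of_shift hm hr hN ha (by omega) haN ?_
    have haz : (p : ℤ) = r + m * (s + 1) := by rw [ha]; push_cast; ring
    have h1 : LocalDvd (qInteger p) 1 (1 - qVar ^ (-(m * s) - m - r : ℤ)) :=
      localDvd_one_one_sub ⟨-1, by rw [haz]; ring⟩
    -- The coefficient of the shifted sum gives one factor `[p]`. The other one comes from its other
    -- factor if `s = 0`, and from each summand, through `i = s - 1`, if `s > 0`.
    rcases Nat.eq_zero_or_pos s with rfl | hs
    · refine LocalDvd.mul_integral (LocalDvd.mul (m := 1) (n := 1)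
        (localDvd_one_one_sub ⟨-1, by rw [haz]; push_cast; ring⟩) h1)
        (LocalDvd.sum fun k hk => localDvd_qSummand hm1 ?_)
      have := Finset.mem_Icc.1 hk
      omega
    · refine LocalDvd.mul (m := 1) (n := 1) ((localDvd_one_sub _).integral_mul h1)
        (LocalDvd.sum fun k hk => ?_)
      have := Finset.mem_Icc.1 hk
      refine localDvd_one_qSummand hm1 (i := s - 1) (by omega) (by omega) ⟨1, ?_⟩
      rw [haz]; push_cast [hs]; ring
  | succ d ih =>
    intro r hr ha haN
    refine localDvd_sum_of_shift hm hr hN ha (by omega) haN ?_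
    have := ih (r + 2 * m) (by omega) (by rw [ha]; ring) (by omega)
    push_cast at this
    exact ((localDvd_one_sub _).mul_integral (localDvd_one_sub _)).integral_mul this

/-! ### Specialization to the three bases -/

theorem legendreSym_neg_three (hp5 : 5 ≤ p) :
    legendreSym p (-3) = if p % 3 = 1 then 1 else -1 := by
  have h2 : p ≠ 2 := by omega
  have hodd : p % 2 = 1 := hp.out.eq_two_or_odd.resolve_left h2
  have h3 := legendreSym.quadratic_reciprocity' (p := 3) (q := p) (by norm_num) h2
  rw [show (-3 : ℤ) = -1 * (3 : ℕ) by rfl, legendreSym.mul, legendreSym.at_neg_one h2, h3,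
    ZMod.χ₄_eq_neg_one_pow hodd, ← mul_assoc, ← pow_add, legendreSym.mod]
  rw [show p / 2 + 3 / 2 * (p / 2) = 2 * (p / 2) by omega, pow_mul]
  have h30 : p % 3 ≠ 0 := fun h =>
    absurd ((Nat.prime_dvd_prime_iff_eq Nat.prime_three hp.out).1 (Nat.dvd_of_mod_eq_zero h))
      (by omega)
  have h12 : p % 3 = 1 ∨ p % 3 = 2 := by omega
  have hc : (p : ℤ) % (3 : ℕ) = ((p % 3 : ℕ) : ℤ) := by push_cast; rfl
  rw [hc]
  rcases h12 with h | h
  · rw [h]; simp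
  · rw [h]; simp; decide
end

section
variable (p : ℕ) [hp : Fact p.Prime]

/-- The common form of the three congruences: the base is `q ^ m`, the parameters are `q ^ r` and
`q ^ t` with `r + t = m`, and `p = r + m a`. -/
theorem ratCongr_sum {m r t s a : ℕ} (hp5 : 5 ≤ p) (hm : ¬ p ∣ m) (hm2 : 2 ≤ m) (hr : 0 < r)
    (hrt : r + t = m)
    (ha : p = r + m * a) (hsa : s ≤ a) (hodd : (s + a) % 2 = 1) :
    RatCongr (qInteger p ^ 2)
      (∑ k ∈ Finset.Icc s ((p - 1) / 2),
        qBinomial (qVar ^ m) (2 * k) (k + s) *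
          (qShifted (qVar ^ r) (qVar ^ m) k * qShifted (qVar ^ t) (qVar ^ m) k * qVar ^ (m * k) /
            qShifted (qVar ^ (2 * m)) (qVar ^ (2 * m)) k ^ 2)) 0 := by
  have hp2 : p % 2 = 1 := hp.out.eq_two_or_odd.resolve_left (by omega)
  have h2m : ¬ p ∣ 2 * m := fun h =>
    (hp.out.dvd_mul.1 h).elim (fun h => absurd (Nat.le_of_dvd two_pos h) (by omega)) hm
  obtain ⟨d, hd⟩ : ∃ d, a = s + 1 + 2 * d := ⟨(a - s - 1) / 2, by omega⟩
  have haN : a ≤ (p - 1) / 2 := by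
    have : 2 * a ≤ m * a := Nat.mul_le_mul_right a hm2
    omega
  subst hd
  have key := (localDvd_sum_qSummand h2m (by omega) d r hr ha haN).ratCongr
  convert key using 1
  refine Finset.sum_congr rfl fun k _ => ?_
  have e : qVar ^ m / qVar ^ r = qVar ^ t := by
    rw [div_eq_iff (pow_ne_zero _ qVar_ne_zero), ← pow_add, ← hrt, add_comm]
  rw [qSummand, qWeight, zpow_natCast, zpow_natCast, e, ← pow_mul, ← pow_mul, mul_comm m 2]
  ring

end

theorem corollary2p4 (p : ℕ) [Fact p.Prime] (hp : 5 ≤ p) (s : ℕ) :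
    ((s : ℚ) ≤ ((p : ℚ) - 1) / 3 → (s : ℤ) ≡ (1 + legendreSym p (-3)) / 2 [ZMOD 2] →
      RatCongr (qInteger p ^ 2)
        (∑ k ∈ Finset.Icc s ((p - 1) / 2),
          qBinomial (qVar ^ 3) (2 * k) (k + s) *
            (qShifted qVar (qVar ^ 3) k * qShifted (qVar ^ 2) (qVar ^ 3) k * qVar ^ (3 * k) /
              qShifted (qVar ^ 6) (qVar ^ 6) k ^ 2)) 0) ∧
    ((s : ℚ) ≤ ((p : ℚ) - 1) / 4 → (s : ℤ) ≡ (1 + legendreSym p (-2)) / 2 [ZMOD 2] →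
      RatCongr (qInteger p ^ 2)
        (∑ k ∈ Finset.Icc s ((p - 1) / 2),
          qBinomial (qVar ^ 4) (2 * k) (k + s) *
            (qShifted qVar (qVar ^ 4) k * qShifted (qVar ^ 3) (qVar ^ 4) k * qVar ^ (4 * k) /
              qShifted (qVar ^ 8) (qVar ^ 8) k ^ 2)) 0) ∧
    ((s : ℚ) ≤ ((p : ℚ) - 1) / 6 → (s : ℤ) ≡ (1 + legendreSym p (-1)) / 2 [ZMOD 2] →
      RatCongr (qInteger p ^ 2)
        (∑ k ∈ Finset.Icc s ((p - 1) / 2),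
          qBinomial (qVar ^ 6) (2 * k) (k + s) *
            (qShifted qVar (qVar ^ 6) k * qShifted (qVar ^ 5) (qVar ^ 6) k * qVar ^ (6 * k) /
              qShifted (qVar ^ 12) (qVar ^ 12) k ^ 2)) 0) := by
  have hpr : p.Prime := Fact.out
  have h2 : p ≠ 2 := by omega
  have hp2 : p % 2 = 1 := hpr.eq_two_or_odd.resolve_left h2
  have hp3 : p % 3 ≠ 0 := fun h =>
    absurd ((Nat.prime_dvd_prime_iff_eq Nat.prime_three hpr).1 (Nat.dvd_of_mod_eq_zero h))
      (by omega)
  have bound : ∀ m : ℕ, 0 < m → (s : ℚ) ≤ ((p : ℚ) - 1) / m → m * s + 1 ≤ p := fun m hm h => by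
    rw [le_div_iff₀ (by exact_mod_cast hm)] at h
    have : (m : ℚ) * s + 1 ≤ p := by linarith
    exact_mod_cast this
  have small : ∀ q : ℕ, q < 5 → 0 < q → ¬ p ∣ q := fun q hq h0 h =>
    absurd (Nat.le_of_dvd h0 h) (by omega)
  have n6 : ¬ p ∣ 2 * 3 := fun h =>
    (hpr.dvd_mul.1 h).elim (small 2 (by norm_num) (by norm_num))
      (small 3 (by norm_num) (by norm_num))
  refine ⟨fun hs hpar => ?_, fun hs hpar => ?_, fun hs hpar => ?_⟩
  · have hb := bound 3 (by norm_num) hs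
    rw [legendreSym_neg_three hp] at hpar
    have h12 : p % 3 = 1 ∨ p % 3 = 2 := by omega
    rcases h12 with h | h
    · rw [if_pos h, Int.ModEq] at hpar
      simpa using ratCongr_sum p (m := 3) (r := 1) (t := 2) (s := s) (a := p / 3) hp
        (small 3 (by norm_num) (by norm_num)) (by norm_num) (by norm_num) (by norm_num)
        (by omega) (by omega) (by omega)
    · rw [if_neg (by omega), Int.ModEq] at hpar
      simpa [mul_comm (qShifted qVar _ _)] using ratCongr_sum p (m := 3) (r := 2) (t := 1) (s := s)
        (a := p / 3) hp (small 3 (by norm_num) (by norm_num)) (by norm_num) (by norm_num)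
        (by norm_num) (by omega) (by omega) (by omega)
  · have hb := bound 4 (by norm_num) hs
    rw [legendreSym.at_neg_two h2, ZMod.χ₈'_nat_eq_if_mod_eight, if_neg (by omega), Int.ModEq]
      at hpar
    have h13 : p % 4 = 1 ∨ p % 4 = 3 := by omega
    rcases h13 with h | h
    · simpa using ratCongr_sum p (m := 4) (r := 1) (t := 3) (s := s) (a := p / 4) hp
        (small 4 (by norm_num) (by norm_num)) (by norm_num) (by norm_num) (by norm_num)
        (by omega) (by omega) (by split_ifs at hpar <;> omega)
    · simpa [mul_comm (qShifted qVar _ _)] using ratCongr_sum p (m := 4) (r := 3) (t := 1) (s := s)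
        (a := p / 4) hp (small 4 (by norm_num) (by norm_num)) (by norm_num) (by norm_num)
        (by norm_num) (by omega) (by omega) (by split_ifs at hpar <;> omega)
  · have hb := bound 6 (by norm_num) hs
    rw [legendreSym.at_neg_one h2, ZMod.χ₄_nat_eq_if_mod_four, if_neg (by omega), Int.ModEq]
      at hpar
    have h15 : p % 6 = 1 ∨ p % 6 = 5 := by omega
    rcases h15 with h | h
    · simpa using ratCongr_sum p (m := 6) (r := 1) (t := 5) (s := s) (a := p / 6) hp
        n6 (by norm_num) (by norm_num) (by norm_num)
        (by omega) (by omega) (by split_ifs at hpar <;> omega)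
    · simpa [mul_comm (qShifted qVar _ _)] using ratCongr_sum p (m := 6) (r := 5) (t := 1) (s := s)
        (a := p / 6) hp n6 (by norm_num) (by norm_num)
        (by norm_num) (by omega) (by omega) (by split_ifs at hpar <;> omega)
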